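/- Let $G$ be a chain graph over a finite, linearly ordered node set $V$: a graph with undirected edges $u - v$ and directed edges $u \to v$, at most one edge between two nodes, no loops, and no directed pseudocycle (no node sequence $v_1,\dots,v_l=v_1$ in which every step is an edge $v_i - v_{i+1}$ or $v_i\to v_{i+1}$, at least one of them directed). Let $B_1,\dots,B_n$ be its connectivity components (the maximal sets of nodes joined by undirected routes) and $Pa(B_i)$ the set of parents of nodes of $B_i$. The moral graph $H^m$ of a chain graph $H$ is the undirected graph in which two distinct nodes are adjacent iff they are adjacent in $H$ or are both parents of nodes of one and the same connectivity component of $H$. Let $\mathcal N(G)$ be the set of Gaussian distributions $p$ on $\mathbb R^V$ with positive definite covariance matrix $\Sigma$ that factorize with respect to $G$, i.e. such that - $p(x)=\prod_{i=1}^n p(x_{B_i}\mid x_{Pa(B_i)})$, and - for every $i$, $p(x_{B_i\cup Pa(B_i)})=\prod_{C}\psi^i_C(x_C)$, where $C$ ranges over the complete sets of $(G_{B_i\cup Pa(B_i)})^m$, the moral graph of the subgraph of $G$ induced by $B_i\cup Pa(B_i)$, and the $\psi^i_C$ are non-negative real functions. (Equalities of densities hold almost everywhere.) For $p\in\mathcal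 N(G)$ let $\Omega^i=(\Sigma_{B_i\cup Pa(B_i),\,B_i\cup Pa(B_i)})^{-1}$ be the precision matrix of the marginal $p(x_{B_i\cup Pa(B_i)})$. The non-determined (nd) parameters of $p$ are: its mean $\mu_j$ and the entry $\Omega^i_{j,j}$ for every node $j\in B_i$; the entry $\Omega^i_{j,k}$ for every undirected edge $j - k$ of $G$ with $j,k\in B_i$ and $k<j$; and the entry $\Omega^i_{j,k}$ for every directed edge $k\to j$ of $G$ with $j\in B_i$. The dimension $d$ of $G$ is the number of nd parameters. Then $d=2|V|+|G|$, where $|G|$ is the number of edges of $G$, and $\mathcal N(G)$ has positive Lebesgue measure with respect to $\mathbb R^d$ in this parameterization: the map that sends $p\in\mathcal N(G)$ to the vector of its nd parameters in $\mathbb R^d$ is injective, and its image is a measurable set of positive Lebesgue measure. -/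

import Mathlib

open MeasureTheory ProbabilityTheory

/-- A chain graph over `V`: undirected edges `und`, directed edges `dir u v` (meaning `u → v`), and
no directed pseudocycle: a directed edge `u → v` cannot be closed up by a descending route
from `v` back to `u`.  In particular two nodes are joined by at most one edge, and there are no
directed loops. -/
structure ChainGraph (V : Type*) where
  /-- the undirected edges -/
  und : SimpleGraph V
  /-- the directed edges -/
  dir : V → V → Prop
  no_pseudocycle : ∀ u v, dir u v →
    ¬ Relation.ReflTransGen (fun a b => und.Adj a b ∨ dir a b) v u

namespace ChainGraph

variable {V : Type*}

/-- The subgraph induced by `I`. -/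
def induce (G : ChainGraph V) (I : Finset V) : ChainGraph I where
  und := G.und.comap (fun i : I => (i : V))
  dir u v := G.dir u v
  no_pseudocycle := by
    intro u v h hr
    exact G.no_pseudocycle u v h
      (hr.lift (fun a : I => (a : V)) (fun _ _ hab => hab))

/-- The underlying undirected graph. -/
def skeleton (G : ChainGraph V) : SimpleGraph V :=
  G.und ⊔ SimpleGraph.fromRel G.dir

/-- `u` is a parent of a node of `I`. -/
def IsParent (G : ChainGraph V) (I : Set V) (u : V) : Prop := ∃ v ∈ I, G.dir u v

/-- The moral graph: two distinct nodes are adjacent iff they are adjacent in `G`, or are both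
parents of one and the same connectivity component of `G`. -/
def moral (G : ChainGraph V) : SimpleGraph V where
  Adj u v := u ≠ v ∧ (G.skeleton.Adj u v ∨
    ∃ c : G.und.ConnectedComponent, G.IsParent c.supp u ∧ G.IsParent c.supp v)
  symm := ⟨fun _ _ h => ⟨h.1.symm, h.2.imp (fun h => h.symm) (fun ⟨c, h1, h2⟩ => ⟨c, h2, h1⟩)⟩⟩
  loopless := ⟨fun _ h => h.1 rfl⟩

section Fin

variable [Fintype V]

open Classical in
/-- The connectivity component `c`, as a finset of nodes. -/
noncomputable def block (G : ChainGraph V) (c : G.und.ConnectedComponent) : Finset V :=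
  Finset.univ.filter fun v => v ∈ c.supp

open Classical in
/-- The set of parents of the connectivity component `c`. -/
noncomputable def pa (G : ChainGraph V) (c : G.und.ConnectedComponent) : Finset V :=
  Finset.univ.filter fun v => G.IsParent c.supp v

open Classical in
/-- The union of the connectivity component `c` and the set of its parents. -/
noncomputable def family (G : ChainGraph V) (c : G.und.ConnectedComponent) : Finset V :=
  G.block c ∪ G.pa c

/-- The connectivity component of a node. -/
def comp (G : ChainGraph V) (v : V) : G.und.ConnectedComponent := G.und.connectedComponentMk v

theorem self_mem_family (G : ChainGraph V) (v : V) : v ∈ G.family (G.comp v) := by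
  simp only [family, block, Finset.mem_union, Finset.mem_filter, Finset.mem_univ, true_and]
  exact Or.inl rfl

theorem und_mem_family (G : ChainGraph V) {j k : V} (h : G.und.Adj j k) :
    k ∈ G.family (G.comp j) := by
  simp only [family, block, Finset.mem_union, Finset.mem_filter, Finset.mem_univ, true_and]
  exact Or.inl (SimpleGraph.ConnectedComponent.sound h.symm.reachable)

theorem dir_mem_family (G : ChainGraph V) {j k : V} (h : G.dir k j) :
    k ∈ G.family (G.comp j) := by
  simp only [family, pa, Finset.mem_union, Finset.mem_filter, Finset.mem_univ, true_and]
  exact Or.inr ⟨j, rfl, h⟩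

/-- The number of edges of `G`. -/
noncomputable def numEdges (G : ChainGraph V) : ℕ := G.skeleton.edgeSet.ncard

/-- The dimension of `G`. -/
noncomputable def dim (G : ChainGraph V) : ℕ := 2 * Fintype.card V + G.numEdges

/-- The Lebesgue density `p(x_I)` of the marginal on the coordinates in `I` of a distribution. -/
noncomputable def density (p : Measure (EuclideanSpace ℝ V)) (I : Finset V) (x : I → ℝ) : ℝ :=
  ((p.map fun (y : EuclideanSpace ℝ V) (i : I) => y i).rnDeriv volume x).toReal

/-- The conditional density `p(x_B | x_{Pa(B)})`, where `B` is the connectivity component `c`. -/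
noncomputable def condDensity (G : ChainGraph V) (p : Measure (EuclideanSpace ℝ V))
    (c : G.und.ConnectedComponent) (x : V → ℝ) : ℝ :=
  density p (G.family c) ((G.family c).restrict x) / density p (G.pa c) ((G.pa c).restrict x)

open Classical in
/-- The complete sets of nodes of an undirected graph. -/
noncomputable def completeSets {W : Type*} [Fintype W] (H : SimpleGraph W) : Finset (Finset W) :=
  Finset.univ.filter fun C => H.IsClique (C : Set W)

open Classical in
/-- `p` factorizes with respect to `G`.  Equality of densities is equality almost everywhere. -/
def Factorizes (G : ChainGraph V) (p : Measure (EuclideanSpace ℝ V)) : Prop :=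
  (∀ᵐ x : V → ℝ, density p Finset.univ (Finset.univ.restrict x) = ∏ c, G.condDensity p c x) ∧
  ∀ c : G.und.ConnectedComponent,
    ∃ ψ : (C : Finset (G.family c)) → (C → ℝ) → ℝ, (∀ C z, 0 ≤ ψ C z) ∧
      ∀ᵐ x : G.family c → ℝ, density p (G.family c) x =
        ∏ C ∈ completeSets (G.induce (G.family c)).moral, ψ C (C.restrict x)

/-- A regular Gaussian distribution: one with positive definite covariance matrix. -/
def IsRegularGaussian [DecidableEq V] (p : Measure (EuclideanSpace ℝ V)) : Prop :=
  ∃ (m : EuclideanSpace ℝ V) (S : Matrix V V ℝ), S.PosDef ∧ p = multivariateGaussian m S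

/-- The set of regular Gaussian distributions that factorize with respect to `G`. -/
def gaussians [DecidableEq V] (G : ChainGraph V) : Set (Measure (EuclideanSpace ℝ V)) :=
  {p | IsRegularGaussian p ∧ G.Factorizes p}

/-- The covariance matrix of `p`. -/
noncomputable def covMatrix (p : Measure (EuclideanSpace ℝ V)) : Matrix V V ℝ :=
  fun i j => cov[fun x => x i, fun x => x j; p]

/-- The precision matrix of the marginal of `p` on a component and its parents. -/
noncomputable def localPrecision [DecidableEq V] (G : ChainGraph V)
    (p : Measure (EuclideanSpace ℝ V)) (c : G.und.ConnectedComponent) :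
    Matrix (G.family c) (G.family c) ℝ :=
  ((covMatrix p).submatrix (fun i : G.family c => (i : V)) (fun i : G.family c => (i : V)))⁻¹

end Fin

/-- The non-determined parameters: one mean and one diagonal entry for each node, one entry below
the diagonal for each undirected edge, and one entry for each directed edge. -/
inductive NdIndex [LT V] (G : ChainGraph V) : Type _
  | mean (v : V)
  | diag (v : V)
  | undirected (j k : V) (h : G.und.Adj j k) (hlt : k < j)
  | directed (j k : V) (h : G.dir k j)

instance [Finite V] [LT V] (G : ChainGraph V) : Finite G.NdIndex := by
  let f : G.NdIndex → Fin 4 × V × V := fun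
    | .mean v => (0, v, v)
    | .diag v => (1, v, v)
    | .undirected j k _ _ => (2, j, k)
    | .directed j k _ => (3, j, k)
  refine Finite.of_injective f ?_
  rintro (_ | _ | _ | _) (_ | _ | _ | _) h <;> simp_all [f]

noncomputable instance [Finite V] [LT V] (G : ChainGraph V) : Fintype G.NdIndex :=
  Fintype.ofFinite _

/-- The values of the non-determined parameters for the distribution `p`. -/
noncomputable def ndParam [Fintype V] [LinearOrder V] (G : ChainGraph V)
    (p : Measure (EuclideanSpace ℝ V)) : G.NdIndex → ℝ
  | .mean v => ∫ x, x v ∂p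
  | .diag v => G.localPrecision p (G.comp v) ⟨v, G.self_mem_family v⟩ ⟨v, G.self_mem_family v⟩
  | .undirected j k h _ =>
      G.localPrecision p (G.comp j) ⟨j, G.self_mem_family j⟩ ⟨k, G.und_mem_family h⟩
  | .directed j k h =>
      G.localPrecision p (G.comp j) ⟨j, G.self_mem_family j⟩ ⟨k, G.dir_mem_family h⟩

end ChainGraph

/-! Arrange the parameters other than the means in two matrices: `D = undMatrix θ`, symmetric and
block diagonal along the connectivity components, and `L = dirMatrix θ`, supported on the directed
edges. The image of `ndParam` is exactly the set of `θ` with `D` positive definite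
(`image_ndParam_gaussians`); it is open and nonempty, hence measurable of positive measure.

If `p` factorizes, its local precision matrices vanish at pairs that are not adjacent in the induced
moral graph, and moralization adds no edge at a node of the component itself. So the rows of the
local precision matrices at component nodes are the rows of `D + L` (`localMatch_ndParam`).
Completing the square, each conditional density is a centred Gaussian density with precision `D_BB`
at the residuals `((1 + D⁻¹L)(x - μ))_B`, and the product over the components has precision `(1 +
D⁻¹L)ᵀ D (1 + D⁻¹L)` (`LocalMatch.prod_gaussianDensity_div`). Hence the parameters determine `Σ`,
which gives injectivity.

Conversely, given `θ` with `D` positive definite, take this matrix as `Σ⁻¹`. By acyclicity `1 +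
D⁻¹L` is unipotent, and its inverse agrees with the identity at the entries that matter, so the
local precision matrices have the prescribed rows (`IsLocalPair.localMatch`) and `p` factorizes. -/

/-! ### Lebesgue densities of Gaussian distributions. -/

section GaussianDensity

variable {W : Type*} [Fintype W] [DecidableEq W]

/-- The Lebesgue density of the Gaussian distribution with mean `m` and precision matrix `P`. -/
noncomputable def gaussianDensity (m : W → ℝ) (P : Matrix W W ℝ) (x : W → ℝ) : ℝ :=
  √P.det * (√(2 * Real.pi))⁻¹ ^ Fintype.card W * Real.exp (-((x - m) ⬝ᵥ P.mulVec (x - m)) / 2)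

theorem continuous_gaussianDensity (m : W → ℝ) (P : Matrix W W ℝ) :
    Continuous (gaussianDensity m P) := by
  unfold gaussianDensity
  fun_prop

theorem gaussianDensity_pos (m : W → ℝ) {P : Matrix W W ℝ} (hP : P.PosDef) (x : W → ℝ) :
    0 < gaussianDensity m P x := by
  have := hP.det_pos
  unfold gaussianDensity
  positivity

theorem pi_gaussianReal_eq_withDensity :
    Measure.pi (fun _ : W => gaussianReal 0 1) =
      (volume : Measure (W → ℝ)).withDensity fun x => ENNReal.ofReal (gaussianDensity 0 1 x) := by
  have hprod : ∀ x : W → ℝ, gaussianDensity 0 1 x = ∏ i, gaussianPDFReal 0 1 (x i) := by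
    intro x
    simp only [gaussianDensity, gaussianPDFReal, Finset.prod_mul_distrib, ← Real.exp_sum,
      Matrix.det_one, Real.sqrt_one, one_mul, sub_zero, Matrix.one_mulVec, dotProduct,
      NNReal.coe_one, mul_one, Finset.prod_const, Finset.card_univ, ← Finset.sum_div,
      Finset.sum_neg_distrib, pow_two]
  refine Measure.pi_eq fun s hs => ?_
  have hint : ∀ i, Integrable (gaussianPDFReal 0 1) ((volume : Measure ℝ).restrict (s i)) :=
    fun i => (integrable_gaussianPDFReal 0 1).restrict
  rw [withDensity_apply _ (MeasurableSet.univ_pi hs)]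
  simp only [hprod]
  rw [volume_pi, Measure.restrict_pi_pi, ← ofReal_integral_eq_lintegral_ofReal
    (Integrable.fintype_prod (fun i => hint i)) (Filter.Eventually.of_forall fun x =>
      Finset.prod_nonneg fun i _ => gaussianPDFReal_nonneg _ _ _), integral_fintype_prod_eq_prod,
      ENNReal.ofReal_prod_of_nonneg]
  · exact Finset.prod_congr rfl fun i _ =>
      (gaussianReal_apply_eq_integral 0 one_ne_zero (s i)).symm
  · exact fun i _ => integral_nonneg fun x => gaussianPDFReal_nonneg _ _ _

theorem map_affine_withDensity {R : Matrix W W ℝ} (hR : R.det ≠ 0) (m : W → ℝ)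
    {f g : (W → ℝ) → ℝ} (hg : Measurable g)
    (hfg : ∀ x, f x = |R.det| * g (m + R.mulVec x)) :
    ((volume : Measure (W → ℝ)).withDensity fun x => ENNReal.ofReal (f x)).map
        (fun x => m + R.mulVec x) =
      volume.withDensity fun x => ENNReal.ofReal (g x) := by
  have hmul : Measurable fun x : W → ℝ => R.mulVec x := by
    have : Continuous fun x : W → ℝ => R.mulVec x := by fun_prop
    exact this.measurable
  have hT : Measurable fun x : W → ℝ => m + R.mulVec x := hmul.const_add m
  have hvol : (volume : Measure (W → ℝ)).map (fun x => m + R.mulVec x) =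
      ENNReal.ofReal |R.det⁻¹| • volume := by
    have h1 : (fun x : W → ℝ => m + R.mulVec x) = (fun x => m + x) ∘ (Matrix.toLin' R) := by
      ext; simp
    rw [h1, ← Measure.map_map (measurable_const_add m) (show Measurable (Matrix.toLin' R) from hmul),
      Real.map_matrix_volume_pi_eq_smul_volume_pi hR, Measure.map_smul, map_add_left_eq_self]
  ext s hs
  rw [Measure.map_apply hT hs, withDensity_apply _ (hT hs), withDensity_apply _ hs]
  simp only [hfg]
  have hF : Measurable fun y => ENNReal.ofReal (|R.det| * g y) := by fun_prop
  rw [← setLIntegral_map hs hF hT, hvol, Measure.restrict_smul, lintegral_smul_measure]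
  simp only [ENNReal.ofReal_mul (abs_nonneg R.det)]
  rw [lintegral_const_mul _ (by fun_prop), smul_eq_mul, ← mul_assoc,
    ← ENNReal.ofReal_mul (abs_nonneg _), ← abs_mul, inv_mul_cancel₀ hR, abs_one,
    ENNReal.ofReal_one, one_mul]

open scoped MatrixOrder in
-- The distribution is the image of the standard Gaussian under `x ↦ m + √S x`; the form `S⁻¹` pulls
-- back along `√S` to `x ⬝ᵥ x`, and the Jacobian cancels `√(det S⁻¹)`.
theorem map_ofLp_multivariateGaussian (m : EuclideanSpace ℝ W) {S : Matrix W W ℝ}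
    (hS : S.PosDef) :
    (multivariateGaussian m S).map (fun y : EuclideanSpace ℝ W => (y : W → ℝ)) =
      volume.withDensity fun x => ENNReal.ofReal (gaussianDensity (fun i => m i) S⁻¹ x) := by
  set R := CFC.sqrt S with hRdef
  have hRR : R * R = S := CFC.sqrt_mul_sqrt_self S hS.posSemidef.nonneg
  have hRH : R.IsHermitian := (Matrix.nonneg_iff_posSemidef.1 (CFC.sqrt_nonneg S)).isHermitian
  have hRt : R.transpose = R := by
    rw [← Matrix.conjTranspose_eq_transpose_of_trivial, hRH.eq]
  have hdet : R.det * R.det = S.det := by rw [← Matrix.det_mul, hRR]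
  have hR : R.det ≠ 0 := by
    intro h
    rw [h, mul_zero] at hdet
    exact hS.det_pos.ne hdet
  have hmeas : Measurable fun x : EuclideanSpace ℝ W => m + Matrix.toEuclideanCLM (𝕜 := ℝ) R x := by
    fun_prop
  rw [multivariateGaussian, ← map_pi_eq_stdGaussian, Measure.map_map hmeas (by fun_prop),
    Measure.map_map (by fun_prop) (hmeas.comp (by fun_prop)), pi_gaussianReal_eq_withDensity]
  refine map_affine_withDensity (R := R) hR (fun i => m i) (f := gaussianDensity 0 1)
    (continuous_gaussianDensity _ _).measurable fun x => ?_
  have hq : (R.mulVec x) ⬝ᵥ S⁻¹.mulVec (R.mulVec x) = x ⬝ᵥ x := by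
    have hu : IsUnit R.det := hR.isUnit
    rw [← hRR, Matrix.mul_inv_rev, Matrix.mulVec_mulVec, Matrix.mul_assoc,
      Matrix.nonsing_inv_mul _ hu, Matrix.mul_one, ← hRt, Matrix.mulVec_transpose,
      ← Matrix.dotProduct_mulVec, hRt, Matrix.mulVec_mulVec, Matrix.mul_nonsing_inv _ hu,
      Matrix.one_mulVec]
  have hs : |R.det| * √(S⁻¹).det = 1 := by
    rw [Matrix.det_nonsing_inv, ← hdet, Ring.inverse_eq_inv', Real.sqrt_inv,
      Real.sqrt_mul_self_eq_abs]
    exact mul_inv_cancel₀ (abs_ne_zero.2 hR)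
  unfold gaussianDensity
  rw [add_sub_cancel_left, hq, ← mul_assoc, ← mul_assoc, hs]
  simp

end GaussianDensity

/-! ### Marginals of Gaussian distributions. -/

namespace ChainGraph

variable {V : Type*} [Fintype V] [DecidableEq V]

/-- A linear image of a Gaussian is Gaussian, so it suffices to compare means and covariances. -/
theorem map_restrict_multivariateGaussian (m : EuclideanSpace ℝ V) {S : Matrix V V ℝ}
    (hS : S.PosSemidef) (I : Finset V) :
    (multivariateGaussian m S).map (fun y : EuclideanSpace ℝ V => fun i : I => y i) =
      (multivariateGaussian (WithLp.toLp 2 fun i : I => m i)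
        (S.submatrix (fun i : I => (i : V)) (fun i : I => (i : V)))).map
          (fun y : EuclideanSpace ℝ I => (y : I → ℝ)) := by
  let L : EuclideanSpace ℝ V →L[ℝ] EuclideanSpace ℝ I :=
    (EuclideanSpace.equiv I ℝ).symm.toContinuousLinearMap.comp
      (ContinuousLinearMap.pi fun i : I => EuclideanSpace.proj (i : V))
  have hL : ∀ y i, L y i = y (i : V) := fun y i => rfl
  have key : (multivariateGaussian m S).map L =
      multivariateGaussian (WithLp.toLp 2 fun i : I => m i)
        (S.submatrix (fun i : I => (i : V)) (fun i : I => (i : V))) := by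
    apply IsGaussian.ext
    · simp only [id_eq, integral_id_multivariateGaussian]
      rw [ContinuousLinearMap.integral_id_map, integral_id_multivariateGaussian]
      · ext i; rfl
      · exact IsGaussian.integrable_id
    rw [← ContinuousLinearMap.toBilinForm_inj]
    refine LinearMap.BilinForm.ext_basis (EuclideanSpace.basisFun I ℝ).toBasis fun i j ↦ ?_
    rw [ContinuousLinearMap.toBilinForm_apply, ContinuousLinearMap.toBilinForm_apply,
      covarianceBilin_apply_eq_cov, covariance_map]
    · have (i : I) : (fun u ↦ inner ℝ ((EuclideanSpace.basisFun I ℝ).toBasis i) u) ∘ L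
          = fun u ↦ u (i : V) := by ext; simp [PiLp.inner_apply, hL]
      simp_rw [this, covariance_eval_multivariateGaussian hS,
        covarianceBilin_multivariateGaussian (hS.submatrix _)]
      simp
    any_goals exact Measurable.aestronglyMeasurable (by fun_prop)
    · fun_prop
    · exact IsGaussian.memLp_two_id
  rw [← key, Measure.map_map (by fun_prop) (by fun_prop)]
  rfl

theorem density_multivariateGaussian (m : EuclideanSpace ℝ V) {S : Matrix V V ℝ}
    (hS : S.PosDef) (I : Finset V) :
    density (multivariateGaussian m S) I =ᵐ[volume]
      gaussianDensity (fun i : I => m i)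
        (S.submatrix (fun i : I => (i : V)) (fun i : I => (i : V)))⁻¹ := by
  have hI : (S.submatrix (fun i : I => (i : V)) (fun i : I => (i : V))).PosDef :=
    hS.submatrix Subtype.val_injective
  have hm : Measurable fun x => ENNReal.ofReal (gaussianDensity (fun i : I => m i)
      (S.submatrix (fun i : I => (i : V)) (fun i : I => (i : V)))⁻¹ x) :=
    (continuous_gaussianDensity _ _).measurable.ennreal_ofReal
  have h := Measure.rnDeriv_withDensity (volume : Measure (I → ℝ)) hm
  filter_upwards [h] with x hx
  rw [density, map_restrict_multivariateGaussian m hS.posSemidef,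
    map_ofLp_multivariateGaussian _ hI, hx,
    ENNReal.toReal_ofReal (gaussianDensity_pos _ hI.inv _).le]

/-- Pulls null sets of the marginal space back to null sets of the full space, where the product
formula is stated. -/
theorem quasiMeasurePreserving_restrict (I : Finset V) :
    Measure.QuasiMeasurePreserving (I.restrict : (V → ℝ) → (I → ℝ)) volume volume := by
  have h := volume_preserving_piEquivPiSubtypeProd (fun _ : V => ℝ) (fun i => i ∈ I)
  convert! Measure.quasiMeasurePreserving_fst.comp h.quasiMeasurePreserving

theorem density_restrict_multivariateGaussian (m : EuclideanSpace ℝ V) {S : Matrix V V ℝ}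
    (hS : S.PosDef) (I : Finset V) :
    ∀ᵐ x : V → ℝ, density (multivariateGaussian m S) I (I.restrict x) =
      gaussianDensity (fun i : I => m i)
        (S.submatrix (fun i : I => (i : V)) (fun i : I => (i : V)))⁻¹ (I.restrict x) :=
  (quasiMeasurePreserving_restrict I).ae (density_multivariateGaussian m hS I)

end ChainGraph

/-! ### Schur complements, and factorization over complete sets. -/

section LinearAlgebra

open Matrix

theorem submatrix_eq_fromBlocks {W B P : Type*} (e : B ⊕ P ≃ W) {Q : Matrix W W ℝ} (hQ : Q.IsHermitian) :
    Q.submatrix e e = fromBlocks (Q.submatrix (e ∘ Sum.inl) (e ∘ Sum.inl))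
      (Q.submatrix (e ∘ Sum.inl) (e ∘ Sum.inr)) (Q.submatrix (e ∘ Sum.inl) (e ∘ Sum.inr))ᴴ
      (Q.submatrix (e ∘ Sum.inr) (e ∘ Sum.inr)) := by
  ext (i | i) (j | j)
  · rfl
  · rfl
  · exact (hQ.apply (e (Sum.inr i)) (e (Sum.inl j))).symm
  · rfl

variable {W B P : Type*} [Fintype W] [DecidableEq W] [Fintype B] [DecidableEq B]
  [Fintype P] [DecidableEq P]

/-- Marginalizing turns a precision matrix into a Schur complement: this is the lower right block of
the inverse of a block matrix. -/
theorem schur_complement_inv (e : B ⊕ P ≃ W) {T : Matrix W W ℝ} (hT : T.PosDef) :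
    (T.submatrix (e ∘ Sum.inr) (e ∘ Sum.inr))⁻¹ =
      T⁻¹.submatrix (e ∘ Sum.inr) (e ∘ Sum.inr) -
        (T⁻¹.submatrix (e ∘ Sum.inl) (e ∘ Sum.inr))ᴴ *
          (T⁻¹.submatrix (e ∘ Sum.inl) (e ∘ Sum.inl))⁻¹ *
            T⁻¹.submatrix (e ∘ Sum.inl) (e ∘ Sum.inr) := by
  set K := T⁻¹.submatrix (e ∘ Sum.inl) (e ∘ Sum.inl) with hK
  set L := T⁻¹.submatrix (e ∘ Sum.inl) (e ∘ Sum.inr) with hL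
  set N := T⁻¹.submatrix (e ∘ Sum.inr) (e ∘ Sum.inr) with hN
  have hKpos : K.PosDef := hT.inv.submatrix (e.injective.comp Sum.inl_injective)
  have hblock : T⁻¹.submatrix e e = fromBlocks K L Lᴴ N := submatrix_eq_fromBlocks e hT.inv.isHermitian
  have hinv : (fromBlocks K L Lᴴ N)⁻¹ = T.submatrix e e := by
    rw [← hblock, inv_submatrix_equiv, nonsing_inv_nonsing_inv _ hT.det_pos.ne'.isUnit]
  let _ : Invertible K := hKpos.isUnit.invertible
  have hdet : IsUnit (fromBlocks K L Lᴴ N).det := by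
    rw [← hblock]
    exact (hT.inv.submatrix e.injective).det_pos.ne'.isUnit
  let _ : Invertible (fromBlocks K L Lᴴ N) := invertibleOfIsUnitDet _ hdet
  let _ : Invertible (N - Lᴴ * ⅟K * L) := invertibleOfFromBlocks₁₁Invertible K L Lᴴ N
  have h := invOf_fromBlocks₁₁_eq K L Lᴴ N
  rw [invOf_eq_nonsing_inv, hinv] at h
  have h22 : T.submatrix (e ∘ Sum.inr) (e ∘ Sum.inr) = ⅟(N - Lᴴ * ⅟K * L) := by
    ext i j
    exact congrFun (congrFun h (Sum.inr i)) (Sum.inr j)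
  rw [h22, ← invOf_eq_nonsing_inv, invOf_invOf, invOf_eq_nonsing_inv]

/-- Completing the square in the `B` coordinates. The residual `z = y_B + K⁻¹ L y_P` enters only
through the equation `K z = (T⁻¹ y)_B`, which is the form checked later. -/
theorem dotProduct_inv_mulVec_eq_add (e : B ⊕ P ≃ W) {T : Matrix W W ℝ} (hT : T.PosDef)
    (y : W → ℝ) {z : B → ℝ}
    (hz : T⁻¹.submatrix (e ∘ Sum.inl) (e ∘ Sum.inl) *ᵥ z = fun b => (T⁻¹ *ᵥ y) (e (Sum.inl b))) :
    y ⬝ᵥ T⁻¹ *ᵥ y =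
      z ⬝ᵥ T⁻¹.submatrix (e ∘ Sum.inl) (e ∘ Sum.inl) *ᵥ z +
        (y ∘ e ∘ Sum.inr) ⬝ᵥ (T.submatrix (e ∘ Sum.inr) (e ∘ Sum.inr))⁻¹ *ᵥ (y ∘ e ∘ Sum.inr) := by
  rw [schur_complement_inv e hT]
  set K := T⁻¹.submatrix (e ∘ Sum.inl) (e ∘ Sum.inl) with hK
  set L := T⁻¹.submatrix (e ∘ Sum.inl) (e ∘ Sum.inr) with hL
  set N := T⁻¹.submatrix (e ∘ Sum.inr) (e ∘ Sum.inr) with hN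
  have hKpos : K.PosDef := hT.inv.submatrix (e.injective.comp Sum.inl_injective)
  have hKdet : IsUnit K.det := hKpos.det_pos.ne'.isUnit
  have hblock : T⁻¹.submatrix e e = fromBlocks K L Lᴴ N := submatrix_eq_fromBlocks e hT.inv.isHermitian
  let _ : Invertible K := hKpos.isUnit.invertible
  have hs := schur_complement_eq₁₁ L N (y ∘ e ∘ Sum.inl) (y ∘ e ∘ Sum.inr) hKpos.isHermitian
  have hy : Sum.elim (y ∘ e ∘ Sum.inl) (y ∘ e ∘ Sum.inr) = y ∘ e := by
    ext (i | i) <;> rfl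
  have hmul : T⁻¹.submatrix e e *ᵥ (y ∘ e) = (T⁻¹ *ᵥ y) ∘ e := by
    rw [submatrix_mulVec_equiv]
    simp [Function.comp_assoc]
  have hz' : y ∘ e ∘ Sum.inl + (K⁻¹ * L) *ᵥ (y ∘ e ∘ Sum.inr) = z := by
    have h1 : K *ᵥ (y ∘ e ∘ Sum.inl + (K⁻¹ * L) *ᵥ (y ∘ e ∘ Sum.inr)) = K *ᵥ z := by
      rw [hz, mulVec_add, mulVec_mulVec, ← Matrix.mul_assoc, mul_nonsing_inv _ hKdet,
        Matrix.one_mul]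
      ext b
      have h2 := congrFun hmul (Sum.inl b)
      rw [hblock, ← hy, fromBlocks_mulVec] at h2
      simpa using h2
    have h3 := congrArg (fun v => K⁻¹ *ᵥ v) h1
    simpa [mulVec_mulVec, nonsing_inv_mul _ hKdet] using h3
  rw [← hblock, hy, hz'] at hs
  simp only [star_trivial, ← dotProduct_mulVec] at hs
  rw [hmul, comp_equiv_dotProduct_comp_equiv] at hs
  exact hs

theorem det_inv_eq_mul (e : B ⊕ P ≃ W) {T : Matrix W W ℝ} (hT : T.PosDef) :
    T⁻¹.det = (T⁻¹.submatrix (e ∘ Sum.inl) (e ∘ Sum.inl)).det *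
      (T.submatrix (e ∘ Sum.inr) (e ∘ Sum.inr))⁻¹.det := by
  rw [schur_complement_inv e hT]
  set K := T⁻¹.submatrix (e ∘ Sum.inl) (e ∘ Sum.inl) with hK
  set L := T⁻¹.submatrix (e ∘ Sum.inl) (e ∘ Sum.inr) with hL
  set N := T⁻¹.submatrix (e ∘ Sum.inr) (e ∘ Sum.inr) with hN
  have hKpos : K.PosDef := hT.inv.submatrix (e.injective.comp Sum.inl_injective)
  have hblock : T⁻¹.submatrix e e = fromBlocks K L Lᴴ N := submatrix_eq_fromBlocks e hT.inv.isHermitian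
  let _ : Invertible K := hKpos.isUnit.invertible
  rw [← det_submatrix_equiv_self e, hblock, det_fromBlocks₁₁, invOf_eq_nonsing_inv]

theorem eq_of_dotProduct_mulVec_eq {M N : Matrix W W ℝ} (hM : M.IsHermitian)
    (hN : N.IsHermitian) (h : ∀ y, y ⬝ᵥ M *ᵥ y = y ⬝ᵥ N *ᵥ y) : M = N := by
  -- Polarization.
  have key : ∀ {M : Matrix W W ℝ}, M.IsHermitian → ∀ i j,
      2 * M i j = (Pi.single i 1 + Pi.single j 1) ⬝ᵥ M *ᵥ (Pi.single i 1 + Pi.single j 1) -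
        Pi.single i 1 ⬝ᵥ M *ᵥ Pi.single i 1 - Pi.single j 1 ⬝ᵥ M *ᵥ Pi.single j 1 := by
    intro M hM i j
    have := hM.apply i j
    simp only [star_trivial] at this
    simp [mulVec_add, add_dotProduct, dotProduct_add, this]
    ring
  ext i j
  have h1 := key hM i j
  have h2 := key hN i j
  simp only [h] at h1
  linarith

/-- A Gaussian density that factorizes almost everywhere over the complete sets of a graph has a
precision matrix that vanishes at the pairs of nonadjacent nodes. -/
theorem precision_eq_zero_of_factorization (H : SimpleGraph W) (m : W → ℝ) {Q : Matrix W W ℝ}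
    (hQ : Q.PosDef) (ψ : (C : Finset W) → (C → ℝ) → ℝ)
    (h : ∀ᵐ x : W → ℝ, gaussianDensity m Q x =
      ∏ C ∈ ChainGraph.completeSets H, ψ C (C.restrict x))
    {i j : W} (hij : i ≠ j) (hadj : ¬ H.Adj i j) : Q i j = 0 := by
  classical
  have hshift : ∀ a : W → ℝ, ∀ᵐ x : W → ℝ, gaussianDensity m Q (x + a) =
      ∏ C ∈ ChainGraph.completeSets H, ψ C (C.restrict (x + a)) := fun a =>
    (measurePreserving_add_right volume a).quasiMeasurePreserving.ae h
  set u : W → ℝ := Pi.single i 1 with hu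
  set v : W → ℝ := Pi.single j 1 with hv
  -- Translates of a conull set are conull, so the factorization holds at all four corners of some
  -- parallelogram.
  obtain ⟨x, h0, h1, h2, h3⟩ := (h.and ((hshift u).and ((hshift v).and (hshift (u + v))))).exists
  set g : (W → ℝ) → ℝ := fun x =>
    ∏ C ∈ (ChainGraph.completeSets H).filter (fun C => i ∈ C), ψ C (C.restrict x) with hg
  set k : (W → ℝ) → ℝ := fun x =>
    ∏ C ∈ (ChainGraph.completeSets H).filter (fun C => ¬ i ∈ C), ψ C (C.restrict x) with hk
  have hsplit : ∀ x : W → ℝ, ∏ C ∈ ChainGraph.completeSets H, ψ C (C.restrict x) = g x * k x :=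
    fun x => (Finset.prod_filter_mul_prod_filter_not _ _ _).symm
  have hgv : ∀ x, g (x + v) = g x := by
    refine fun x => Finset.prod_congr rfl fun C hC => ?_
    simp only [Finset.mem_filter, ChainGraph.completeSets, Finset.mem_univ, true_and] at hC
    have hj : j ∉ C := fun hj => hadj (hC.1 hC.2 hj hij)
    congr 1
    ext c
    have : (c : W) ≠ j := fun hc => hj (hc ▸ c.2)
    simp [hv, this]
  have hku : ∀ x, k (x + u) = k x := by
    refine fun x => Finset.prod_congr rfl fun C hC => ?_
    simp only [Finset.mem_filter] at hC
    congr 1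
    ext c
    have : (c : W) ≠ i := fun hc => hC.2 (hc ▸ c.2)
    simp [hu, this]
  rw [hsplit] at h0 h1 h2 h3
  -- No complete set contains both `i` and `j`, so `g` ignores the shift by `v` and `k` the shift by
  -- `u`. Taking logarithms, the mixed second difference of the quadratic exponent is `-Q i j`, so
  -- it is zero.
  have hmul : gaussianDensity m Q x * gaussianDensity m Q (x + (u + v)) =
      gaussianDensity m Q (x + u) * gaussianDensity m Q (x + v) := by
    rw [h0, h1, h2, h3, ← add_assoc, hgv, hgv, hku, add_right_comm, hku]
    ring
  have hlog : ∀ x, Real.log (gaussianDensity m Q x) =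
      Real.log (√Q.det * (√(2 * Real.pi))⁻¹ ^ Fintype.card W) +
        -((x - m) ⬝ᵥ Q *ᵥ (x - m)) / 2 := by
    intro x
    have := hQ.det_pos
    rw [gaussianDensity, Real.log_mul (by positivity) (by positivity), Real.log_exp]
  have hne : ∀ x, gaussianDensity m Q x ≠ 0 := fun x => (gaussianDensity_pos m hQ x).ne'
  have hl := congrArg Real.log hmul
  rw [Real.log_mul (hne _) (hne _), Real.log_mul (hne _) (hne _), hlog, hlog, hlog, hlog] at hl
  have e1 : x + (u + v) - m = (x - m) + u + v := by abel
  have e2 : x + u - m = (x - m) + u := by abel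
  have e3 : x + v - m = (x - m) + v := by abel
  rw [e1, e2, e3] at hl
  have hsym := hQ.isHermitian.apply i j
  simp only [star_trivial] at hsym
  have huv : u ⬝ᵥ Q *ᵥ v = Q i j := by simp [hu, hv]
  have hvu : v ⬝ᵥ Q *ᵥ u = Q i j := by simp [hu, hv, hsym]
  simp only [mulVec_add, add_dotProduct, dotProduct_add, huv, hvu] at hl
  linarith

/-- A Gaussian density whose precision matrix vanishes at the pairs of nonadjacent nodes of a
graph factorizes over the complete sets of this graph. -/
theorem exists_factorization_of_precision (H : SimpleGraph W) (m : W → ℝ) (Q : Matrix W W ℝ)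
    (h : ∀ i j, i ≠ j → ¬ H.Adj i j → Q i j = 0) :
    ∃ ψ : (C : Finset W) → (C → ℝ) → ℝ, (∀ C z, 0 ≤ ψ C z) ∧
      ∀ x, gaussianDensity m Q x = ∏ C ∈ ChainGraph.completeSets H, ψ C (C.restrict x) := by
  classical
  set c := √Q.det * (√(2 * Real.pi))⁻¹ ^ Fintype.card W with hc
  have hc0 : 0 ≤ c := by positivity
  let y : (C : Finset W) → (C → ℝ) → W → ℝ := fun C z i => if hi : i ∈ C then z ⟨i, hi⟩ - m i else 0
  -- The term of an ordered pair goes to the set of its two entries, so sets with more than two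
  -- elements get the factor 1; the normalizing constant goes to `∅`.
  let ψ : (C : Finset W) → (C → ℝ) → ℝ := fun C z => (if C = ∅ then c else 1) *
    Real.exp (-(∑ p ∈ Finset.univ.filter (fun p : W × W => {p.1, p.2} = C),
      y C z p.1 * (Q p.1 p.2 * y C z p.2)) / 2)
  refine ⟨ψ, fun C z => mul_nonneg (by split_ifs <;> positivity) (Real.exp_pos _).le, fun x => ?_⟩
  have hy : ∀ (C : Finset W) i, i ∈ C → y C (C.restrict x) i = (x - m) i := by
    intro C i hi
    simp [y, hi]
  have hempty : (∅ : Finset W) ∈ ChainGraph.completeSets H := by simp [ChainGraph.completeSets]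
  simp only [ψ]
  rw [Finset.prod_mul_distrib, Finset.prod_ite_eq' , if_pos hempty, ← Real.exp_sum, gaussianDensity]
  congr 2
  rw [← Finset.sum_div, Finset.sum_neg_distrib]
  congr 2
  have hpair : ∀ p : W × W, {p.1, p.2} ∈ ChainGraph.completeSets H ∨ Q p.1 p.2 = 0 := by
    rintro ⟨i, j⟩
    by_cases hij : i = j
    · left; subst hij; simp [ChainGraph.completeSets]
    by_cases hadj : H.Adj i j
    · left
      simp [ChainGraph.completeSets, SimpleGraph.isClique_iff, hadj]
    · exact Or.inr (h i j hij hadj)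
  have hsum : ∀ C ∈ ChainGraph.completeSets H,
      ∑ p ∈ Finset.univ.filter (fun p : W × W => {p.1, p.2} = C),
        y C (C.restrict x) p.1 * (Q p.1 p.2 * y C (C.restrict x) p.2) =
      ∑ p ∈ Finset.univ.filter (fun p : W × W => {p.1, p.2} = C),
        (x - m) p.1 * (Q p.1 p.2 * (x - m) p.2) := by
    intro C _
    refine Finset.sum_congr rfl fun p hp => ?_
    simp only [Finset.mem_filter, Finset.mem_univ, true_and] at hp
    rw [hy C p.1 (by simp [← hp]), hy C p.2 (by simp [← hp])]
  rw [Finset.sum_congr rfl hsum, Finset.sum_fiberwise_eq_sum_filter, Finset.sum_filter_of_ne,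
    Fintype.sum_prod_type]
  · simp [dotProduct, mulVec, Finset.mul_sum]
  · intro p _ hp
    exact (hpair p).resolve_right fun h0 => hp (by rw [h0, zero_mul, mul_zero])

end LinearAlgebra

/-! ### Acyclicity, block diagonal matrices and unipotent matrices. -/

namespace ChainGraph

open Matrix

section Before

variable {V : Type*} (G : ChainGraph V)

/-- There is a descending route from `u` to `v`. -/
def Desc : V → V → Prop := Relation.ReflTransGen fun a b => G.und.Adj a b ∨ G.dir a b

/-- There is a descending route from `u` to `v` with a directed edge. -/
def Before (u v : V) : Prop := ∃ a b, G.Desc u a ∧ G.dir a b ∧ G.Desc b v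

variable {G}

theorem not_before_self (u : V) : ¬ G.Before u u := fun ⟨a, b, h1, h2, h3⟩ =>
  G.no_pseudocycle a b h2 (h3.trans h1)

theorem Before.trans {u v w : V} (h : G.Before u v) (h' : G.Before v w) : G.Before u w := by
  obtain ⟨a, b, h1, h2, h3⟩ := h
  obtain ⟨a', b', h1', h2', h3'⟩ := h'
  exact ⟨a, b, h1, h2, h3.trans (h1'.trans (.head (Or.inr h2') h3'))⟩

theorem wellFounded_before [Finite V] : WellFounded G.Before := by
  have : IsTrans V G.Before := ⟨fun _ _ _ => Before.trans⟩
  have : Std.Irrefl G.Before := ⟨not_before_self⟩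
  exact Finite.wellFounded_of_trans_of_irrefl _

theorem desc_of_comp_eq {u v : V} (h : G.comp u = G.comp v) : G.Desc u v := by
  have hr := SimpleGraph.ConnectedComponent.exact h
  rw [SimpleGraph.reachable_iff_reflTransGen] at hr
  exact Relation.ReflTransGen.mono (fun _ _ => Or.inl) _ _ hr

theorem before_of_dir {u v w : V} (h : G.dir u v) (h' : G.comp v = G.comp w) : G.Before u w :=
  ⟨u, v, .refl, h, desc_of_comp_eq h'⟩

theorem not_dir_of_comp_eq {u v : V} (h : G.comp u = G.comp v) : ¬ G.dir u v := fun h' =>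
  G.no_pseudocycle u v h' (desc_of_comp_eq h.symm)

end Before

section Components

variable {V : Type*} [Fintype V] (G : ChainGraph V)

theorem mem_block {c : G.und.ConnectedComponent} {v : V} : v ∈ G.block c ↔ G.comp v = c := by
  simp [block, comp]

theorem mem_pa {c : G.und.ConnectedComponent} {v : V} :
    v ∈ G.pa c ↔ ∃ w, G.comp w = c ∧ G.dir v w := by
  simp only [pa, Finset.mem_filter, Finset.mem_univ, true_and]
  rfl

theorem mem_family {c : G.und.ConnectedComponent} {v : V} :
    v ∈ G.family c ↔ v ∈ G.block c ∨ v ∈ G.pa c := by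
  simp [family]

theorem not_mem_pa_of_mem_block {c : G.und.ConnectedComponent} {v : V} (h : v ∈ G.block c) :
    v ∉ G.pa c := by
  rw [mem_block] at h
  rw [mem_pa]
  rintro ⟨w, hw, hd⟩
  exact not_dir_of_comp_eq (h.trans hw.symm) hd

/-- Each node of the family has a descending route to `b`; a route back with a directed edge would
close a pseudocycle. -/
theorem not_before_of_mem_family {b v : V} (hv : v ∈ G.family (G.comp b)) : ¬ G.Before b v := by
  rintro ⟨a, a', h1, h2, h3⟩
  rw [mem_family, mem_block, mem_pa] at hv
  have hvb : G.Desc v b := by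
    rcases hv with hv | ⟨w, hw, hd⟩
    · exact desc_of_comp_eq hv
    · exact .head (Or.inr hd) (desc_of_comp_eq hw)
  exact G.no_pseudocycle a a' h2 (h3.trans (hvb.trans h1))

/-- The family of a connectivity component is the disjoint union of the component and the set of
its parents. -/
noncomputable def familyEquiv (c : G.und.ConnectedComponent) :
    G.block c ⊕ G.pa c ≃ G.family c :=
  Equiv.ofBijective
    (Sum.elim (fun b => ⟨b, G.mem_family.2 (Or.inl b.2)⟩) (fun b => ⟨b, G.mem_family.2 (Or.inr b.2)⟩))
    (by
      constructor
      · rintro (⟨a, ha⟩ | ⟨a, ha⟩) (⟨b, hb⟩ | ⟨b, hb⟩) h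
        · simpa using h
        · obtain rfl : a = b := by simpa using h
          exact absurd hb (G.not_mem_pa_of_mem_block ha)
        · obtain rfl : a = b := by simpa using h
          exact absurd ha (G.not_mem_pa_of_mem_block hb)
        · simpa using h
      · rintro ⟨a, ha⟩
        rcases G.mem_family.1 ha with h | h
        · exact ⟨Sum.inl ⟨a, h⟩, rfl⟩
        · exact ⟨Sum.inr ⟨a, h⟩, rfl⟩)

theorem sum_coe_eq_sum {I : Finset V} (f : V → ℝ) (h : ∀ v, v ∉ I → f v = 0) :
    ∑ v : I, f v = ∑ v, f v := by
  rw [Finset.sum_coe_sort]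
  exact Finset.sum_subset (Finset.subset_univ _) fun v _ hv => h v hv

variable [Fintype G.und.ConnectedComponent]

theorem sum_block {M : Type*} [AddCommMonoid M] (f : V → M) :
    ∑ c, ∑ b : G.block c, f b = ∑ v, f v := by
  classical
  rw [← Finset.sum_fiberwise _ G.comp]
  refine Finset.sum_congr rfl fun c _ => ?_
  rw [Finset.sum_coe_sort]
  refine Finset.sum_congr ?_ fun _ _ => rfl
  ext v
  simp [mem_block]

theorem sum_card_block : ∑ c, Fintype.card (G.block c) = Fintype.card V := by
  simp only [Fintype.card, Finset.card_eq_sum_ones]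
  exact G.sum_block fun _ => 1

end Components

section BlockDiagonal

variable {V : Type*} {G : ChainGraph V} {D : Matrix V V ℝ}

/-- The principal submatrix with rows and columns in `I`. -/
def principal (D : Matrix V V ℝ) (I : Finset V) : Matrix I I ℝ :=
  D.submatrix (fun i : I => (i : V)) (fun i : I => (i : V))

theorem posDef_principal (hD : D.PosDef) (I : Finset V) : (principal D I).PosDef :=
  hD.submatrix Subtype.val_injective

variable [Fintype V]

theorem mulVec_principal_block (hD : ∀ u v, D u v ≠ 0 → G.comp u = G.comp v)
    (c : G.und.ConnectedComponent) (z : V → ℝ) :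
    principal D (G.block c) *ᵥ (fun b => z b) = fun b : G.block c => (D *ᵥ z) b := by
  ext b
  simp only [mulVec, dotProduct, principal, submatrix_apply]
  refine sum_coe_eq_sum (fun v => D b v * z v) fun v hv => ?_
  by_contra h
  refine hv (G.mem_block.2 ?_)
  rw [← hD b v (left_ne_zero_of_mul h)]
  exact G.mem_block.1 b.2

variable [Fintype G.und.ConnectedComponent]

theorem sum_dotProduct_principal_block (hD : ∀ u v, D u v ≠ 0 → G.comp u = G.comp v) (z : V → ℝ) :
    ∑ c, (fun b : G.block c => z b) ⬝ᵥ principal D (G.block c) *ᵥ (fun b => z b) =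
      z ⬝ᵥ D *ᵥ z := by
  simp only [mulVec_principal_block hD]
  exact G.sum_block fun v => z v * (D *ᵥ z) v

theorem posDef_of_principal_block (hD : ∀ u v, D u v ≠ 0 → G.comp u = G.comp v)
    (hH : D.IsHermitian) (h : ∀ c, (principal D (G.block c)).PosDef) : D.PosDef := by
  refine PosDef.of_dotProduct_mulVec_pos hH fun x hx => ?_
  rw [star_trivial, ← sum_dotProduct_principal_block hD]
  obtain ⟨v, hv⟩ := Function.ne_iff.1 hx
  refine Finset.sum_pos' (fun c _ => ?_) ⟨G.comp v, Finset.mem_univ _, ?_⟩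
  · simpa using (h c).posSemidef.dotProduct_mulVec_nonneg (fun b => x b)
  · have hne : (fun b : G.block (G.comp v) => x b) ≠ 0 := fun h0 =>
      hv (congrFun h0 ⟨v, G.mem_block.2 rfl⟩)
    simpa using (h (G.comp v)).dotProduct_mulVec_pos hne

variable [DecidableEq V]

theorem det_eq_prod_principal_block (hD : ∀ u v, D u v ≠ 0 → G.comp u = G.comp v) :
    D.det = ∏ c, (principal D (G.block c)).det := by
  classical
  -- Any order will do: the matrix is block diagonal, hence block triangular for each of them.
  let _ : LinearOrder G.und.ConnectedComponent :=
    LinearOrder.lift' (Fintype.equivFin _) (Fintype.equivFin _).injective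
  have hB : BlockTriangular D G.comp := fun u v h => by
    by_contra h0
    exact h.ne (hD u v h0).symm
  rw [hB.det_fintype]
  refine Finset.prod_congr rfl fun c _ => ?_
  rw [← det_submatrix_equiv_self
    (Equiv.subtypeEquivRight fun v => G.mem_block.symm : {v // G.comp v = c} ≃ G.block c)]
  rfl

end BlockDiagonal

section Triangular

variable {V : Type*} [Fintype V] [DecidableEq V] {G : ChainGraph V}

theorem comp_eq_of_inv_ne_zero {D : Matrix V V ℝ} (hD : ∀ u v, D u v ≠ 0 → G.comp u = G.comp v) (hdet : IsUnit D.det)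
    (u v : V) (h : D⁻¹ u v ≠ 0) : G.comp u = G.comp v := by
  classical
  -- `D⁻¹` truncated to the blocks is still a right inverse of `D`, so it is `D⁻¹`.
  let E : Matrix V V ℝ := fun u v => if G.comp u = G.comp v then D⁻¹ u v else 0
  have hE : D * E = 1 := by
    have h1 := mul_nonsing_inv D hdet
    ext u v
    by_cases huv : G.comp u = G.comp v
    · rw [← h1, mul_apply, mul_apply]
      refine Finset.sum_congr rfl fun w _ => ?_
      by_cases hw : D u w = 0
      · simp [hw]
      · simp [E, ← hD u w hw, huv]
    · rw [mul_apply, one_apply_ne (ne_of_apply_ne G.comp huv)]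
      refine Finset.sum_eq_zero fun w _ => ?_
      by_cases hw : D u w = 0
      · simp [hw]
      · simp [E, ← hD u w hw, huv]
  rw [inv_eq_right_inv hE] at h
  by_contra huv
  simp [E, huv] at h

variable {M : Matrix V V ℝ}

/-- The number `r` of predecessors strictly increases along `Before`, so the transpose is block
triangular for `r` with identity diagonal blocks. -/
theorem det_one_add_of_before (hM : ∀ u v, M u v ≠ 0 → G.Before v u) : (1 + M).det = 1 := by
  classical
  let r : V → ℕ := fun v => (Finset.univ.filter fun u => G.Before u v).card
  have hr : ∀ u v, G.Before u v → r u < r v := by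
    intro u v huv
    refine Finset.card_lt_card (Finset.ssubset_iff_of_subset ?_ |>.2 ⟨u, ?_, ?_⟩)
    · intro w hw
      simp only [Finset.mem_filter, Finset.mem_univ, true_and] at hw ⊢
      exact hw.trans huv
    · simpa using huv
    · simpa using not_before_self u
  have hB : BlockTriangular (1 + M)ᵀ r := by
    intro i j hij
    have hne : j ≠ i := by rintro rfl; exact lt_irrefl _ hij
    have h0 : M j i = 0 := by
      by_contra h
      exact (hr i j (hM j i h)).not_gt hij
    simp [one_apply_ne hne, h0]
  rw [← det_transpose, hB.det]
  refine Finset.prod_eq_one fun k _ => ?_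
  rw [← det_one (R := ℝ) (n := {v // r v = k})]
  congr 1
  ext ⟨i, hi⟩ ⟨j, hj⟩
  have h0 : M j i = 0 := by
    by_contra h
    have := hr i j (hM j i h)
    omega
  simp [toSquareBlock, toSquareBlockProp, h0, one_apply]

/-- Well-founded induction on the row: in `X v b + ∑ u, M v u * X u b = 1 v b` only `u` before `v`
contribute. Such a `u` is neither `b` nor preceded by `b`, so `X u b = 0`. -/
theorem inv_one_add_apply (hM : ∀ u v, M u v ≠ 0 → G.Before v u) {b : V} :
    ∀ v, ¬ G.Before b v → (1 + M)⁻¹ v b = (1 : Matrix V V ℝ) v b := by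
  have hdet : IsUnit (1 + M).det := by rw [det_one_add_of_before hM]; exact isUnit_one
  have h1 := mul_nonsing_inv _ hdet
  rw [add_mul, one_mul] at h1
  intro v
  induction v using (wellFounded_before (G := G)).induction with
  | _ v ih =>
    intro hv
    have h2 := congrFun (congrFun h1 v) b
    rw [Matrix.add_apply, mul_apply, Finset.sum_eq_zero, add_zero] at h2
    · exact h2
    intro u _
    by_cases hu : M v u = 0
    · rw [hu, zero_mul]
    have huv := hM v u hu
    rw [ih u huv fun h => hv (h.trans huv), one_apply_ne, mul_zero]
    rintro rfl
    exact hv huv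

end Triangular

end ChainGraph

/-! ### Reindexing, and uniqueness of the precision matrix. -/

section Reindex

variable {W W' : Type*} [Fintype W] [DecidableEq W] [Fintype W'] [DecidableEq W']

theorem gaussianDensity_comp_equiv (e : W' ≃ W) (m : W → ℝ) (Q : Matrix W W ℝ) (x : W → ℝ) :
    gaussianDensity (m ∘ e) (Q.submatrix e e) (x ∘ e) = gaussianDensity m Q x := by
  have hs : x ∘ e - m ∘ e = (x - m) ∘ e := rfl
  rw [gaussianDensity, gaussianDensity, Matrix.det_submatrix_equiv_self, Fintype.card_congr e, hs,
    Matrix.submatrix_mulVec_equiv]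
  simp only [Function.comp_assoc, Equiv.self_comp_symm, Function.comp_id]
  rw [comp_equiv_dotProduct_comp_equiv]

theorem precision_eq_of_gaussianDensity_eq {m : W → ℝ} {Q Q' : Matrix W W ℝ} (hQ : Q.PosDef)
    (hQ' : Q'.IsHermitian) (h : gaussianDensity m Q = gaussianDensity m Q') : Q = Q' := by
  refine eq_of_dotProduct_mulVec_eq hQ.isHermitian hQ' fun y => ?_
  -- At the mean the exponents vanish and the normalizing constants agree; at `m + y` the quadratic
  -- forms can then be compared.
  have h0 := congrFun h m
  have h1 := congrFun h (m + y)
  have hpos := gaussianDensity_pos m hQ m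
  simp only [gaussianDensity, sub_self, zero_dotProduct, neg_zero, zero_div, Real.exp_zero,
    mul_one, add_sub_cancel_left] at h0 h1 hpos
  rw [← h0] at h1
  have h2 := Real.exp_injective (mul_left_cancel₀ hpos.ne' h1)
  linarith

end Reindex

/-! ### Gluing the local precision matrices. -/

namespace ChainGraph

open Matrix

variable {V : Type*} [Fintype V] [DecidableEq V] {G : ChainGraph V}

/-- The precision matrix of the distribution with precision `D` on the residuals and regression
coefficients `-D⁻¹ * L`. -/
noncomputable def gluedPrecision (D L : Matrix V V ℝ) : Matrix V V ℝ :=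
  (1 + D⁻¹ * L)ᵀ * D * (1 + D⁻¹ * L)

/-- The rows of the precision matrices of the marginals of `S` on the families that belong to
the nodes of the respective components are given by `R`. -/
def LocalMatch (G : ChainGraph V) (S R : Matrix V V ℝ) : Prop :=
  ∀ c, ∀ i j : G.family c, (i : V) ∈ G.block c → (principal S (G.family c))⁻¹ i j = R i j

/-- `D` vanishes between distinct connectivity components, and `L` outside the directed edges. -/
structure IsLocalPair (G : ChainGraph V) (D L : Matrix V V ℝ) : Prop where
  comp_eq : ∀ u v, D u v ≠ 0 → G.comp u = G.comp v
  dir : ∀ u v, L u v ≠ 0 → G.dir v u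

variable {D L S : Matrix V V ℝ}

/-- `L` moves along one directed edge and `D⁻¹` stays inside a component. -/
theorem IsLocalPair.before (h : G.IsLocalPair D L) (hdet : IsUnit D.det) (u v : V)
    (huv : (D⁻¹ * L) u v ≠ 0) : G.Before v u := by
  rw [mul_apply] at huv
  obtain ⟨w, _, hw⟩ := Finset.exists_ne_zero_of_sum_ne_zero huv
  exact before_of_dir (h.dir w v (right_ne_zero_of_mul hw))
    (comp_eq_of_inv_ne_zero h.comp_eq hdet u w (left_ne_zero_of_mul hw)).symm

theorem IsLocalPair.det_gluedPrecision (h : G.IsLocalPair D L) (hdet : IsUnit D.det) :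
    (gluedPrecision D L).det = D.det := by
  rw [gluedPrecision, det_mul, det_mul, det_transpose, det_one_add_of_before (h.before hdet)]
  ring

theorem IsLocalPair.posDef_gluedPrecision (h : G.IsLocalPair D L) (hD : D.PosDef) :
    (gluedPrecision D L).PosDef := by
  have hdet : IsUnit D.det := hD.det_pos.ne'.isUnit
  rw [gluedPrecision, ← conjTranspose_eq_transpose_of_trivial]
  refine hD.conjTranspose_mul_mul_same (mulVec_injective_iff_isUnit.2 ?_)
  rw [isUnit_iff_isUnit_det, det_one_add_of_before (h.before hdet)]
  exact isUnit_one

theorem mul_one_add_inv_mul (hdet : IsUnit D.det) : D * (1 + D⁻¹ * L) = D + L := by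
  rw [mul_add, mul_one, ← Matrix.mul_assoc, mul_nonsing_inv _ hdet, Matrix.one_mul]

theorem IsLocalPair.mem_family {V : Type*} [Fintype V] {G : ChainGraph V} {D L : Matrix V V ℝ}
    (h : G.IsLocalPair D L) {u v : V} (huv : (D + L) u v ≠ 0) :
    v ∈ G.family (G.comp u) := by
  rw [G.mem_family, mem_block, mem_pa]
  by_cases h0 : D u v = 0
  · rw [Matrix.add_apply, h0, zero_add] at huv
    exact Or.inr ⟨u, rfl, h.dir u v huv⟩
  · exact Or.inl (h.comp_eq u v h0).symm

/-- Here `(D + L) S = ((1 + D⁻¹L)⁻¹)ᵀ`. Row `i` of `D + L` is supported in the family of `i`, and no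
family member comes after `i`, so by `inv_one_add_apply` this row times the principal block of `S`
is a unit vector. It is therefore a row of the inverse of that block. -/
theorem IsLocalPair.localMatch (h : G.IsLocalPair D L) (hD : D.PosDef) :
    G.LocalMatch (gluedPrecision D L)⁻¹ (D + L) := by
  have hdet : IsUnit D.det := hD.det_pos.ne'.isUnit
  have hQ := h.posDef_gluedPrecision hD
  have hA : IsUnit (1 + D⁻¹ * L).det := by
    rw [det_one_add_of_before (h.before hdet)]; exact isUnit_one
  set S := (gluedPrecision D L)⁻¹ with hS
  have hmul : (D + L) * S = ((1 + D⁻¹ * L)⁻¹)ᵀ := by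
    rw [hS, gluedPrecision, Matrix.mul_inv_rev, Matrix.mul_inv_rev, ← mul_one_add_inv_mul hdet,
      transpose_nonsing_inv, Matrix.mul_assoc, ← Matrix.mul_assoc (1 + D⁻¹ * L),
      mul_nonsing_inv _ hA, Matrix.one_mul, ← Matrix.mul_assoc, mul_nonsing_inv _ hdet,
      Matrix.one_mul]
  intro c i j hi
  have hT : (principal S (G.family c)).PosDef := posDef_principal hQ.inv _
  have hci : G.comp i = c := G.mem_block.1 hi
  have hrow : (fun k : G.family c => (D + L) i k) ᵥ* principal S (G.family c) = Pi.single i 1 := by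
    ext k
    have h1 : ∑ l : G.family c, (D + L) i l * S l k = ((D + L) * S) i k := by
      rw [mul_apply]
      refine sum_coe_eq_sum (fun l => (D + L) i l * S l k) fun l hl => ?_
      by_contra h0
      exact hl (hci ▸ h.mem_family (left_ne_zero_of_mul h0))
    have h2 := inv_one_add_apply (h.before hdet) (b := (i : V)) k
      (G.not_before_of_mem_family (by rw [hci]; exact k.2))
    change ∑ l : G.family c, (D + L) i l * S l k = _
    rw [h1, hmul, transpose_apply, h2, one_apply, Pi.single_apply]
    simp only [Subtype.coe_inj]
  have h3 := congrArg (fun v => v ᵥ* (principal S (G.family c))⁻¹) hrow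
  simp only [vecMul_vecMul, mul_nonsing_inv _ hT.det_pos.ne'.isUnit, vecMul_one] at h3
  rw [single_one_vecMul] at h3
  exact (congrFun h3 j).symm

theorem LocalMatch.submatrix_inl (hm : G.LocalMatch S (D + L)) (h : G.IsLocalPair D L)
    (c : G.und.ConnectedComponent) :
    (principal S (G.family c))⁻¹.submatrix (G.familyEquiv c ∘ Sum.inl) (G.familyEquiv c ∘ Sum.inl) =
      principal D (G.block c) := by
  ext b b'
  have h0 : L b b' = 0 := by
    by_contra h0
    exact not_dir_of_comp_eq ((G.mem_block.1 b'.2).trans (G.mem_block.1 b.2).symm)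
      (h.dir _ _ h0)
  have h1 := hm c (G.familyEquiv c (Sum.inl b)) (G.familyEquiv c (Sum.inl b')) b.2
  refine h1.trans ?_
  change D b b' + L b b' = D b b'
  rw [h0, add_zero]

/-- The residual is `(1 + D⁻¹L) y` restricted to the block, because `D (1 + D⁻¹L) = D + L` and the
latter has the rows of the local precision matrix. -/
theorem LocalMatch.dotProduct_sub (hm : G.LocalMatch S (D + L)) (h : G.IsLocalPair D L)
    (hS : S.PosDef) (hD : D.PosDef) (c : G.und.ConnectedComponent) (y : V → ℝ) :
    (fun i : G.family c => y i) ⬝ᵥ (principal S (G.family c))⁻¹ *ᵥ (fun i => y i) =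
      (fun b : G.block c => ((1 + D⁻¹ * L : Matrix V V ℝ) *ᵥ y) (b : V)) ⬝ᵥ principal D (G.block c) *ᵥ
        (fun b => ((1 + D⁻¹ * L : Matrix V V ℝ) *ᵥ y) (b : V)) +
      (fun i : G.pa c => y i) ⬝ᵥ (principal S (G.pa c))⁻¹ *ᵥ (fun i => y i) := by
  have hdet : IsUnit D.det := hD.det_pos.ne'.isUnit
  rw [dotProduct_inv_mulVec_eq_add (G.familyEquiv c) (posDef_principal hS _) _
    (z := fun b : G.block c => ((1 + D⁻¹ * L : Matrix V V ℝ) *ᵥ y) (b : V)), hm.submatrix_inl h]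
  · rfl
  · rw [hm.submatrix_inl h, mulVec_principal_block h.comp_eq, mulVec_mulVec,
      mul_one_add_inv_mul hdet]
    ext b
    simp only [mulVec, dotProduct]
    rw [← sum_coe_eq_sum (I := G.family c) fun v => (D + L) b v * y v]
    · exact Finset.sum_congr rfl fun j _ => by rw [hm c _ j b.2]; rfl
    · intro v hv
      by_contra h0
      exact hv (G.mem_block.1 b.2 ▸ h.mem_family (left_ne_zero_of_mul h0))

theorem LocalMatch.det_inv (hm : G.LocalMatch S (D + L)) (h : G.IsLocalPair D L)
    (hS : S.PosDef) (c : G.und.ConnectedComponent) :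
    (principal S (G.family c))⁻¹.det =
      (principal D (G.block c)).det * (principal S (G.pa c))⁻¹.det := by
  rw [det_inv_eq_mul (G.familyEquiv c) (posDef_principal hS _), hm.submatrix_inl h]
  rfl

theorem LocalMatch.gaussianDensity_div (hm : G.LocalMatch S (D + L)) (h : G.IsLocalPair D L)
    (hS : S.PosDef) (hD : D.PosDef) (m x : V → ℝ) (c : G.und.ConnectedComponent) :
    gaussianDensity (fun i : G.family c => m i) (principal S (G.family c))⁻¹ (fun i => x i) /
      gaussianDensity (fun i : G.pa c => m i) (principal S (G.pa c))⁻¹ (fun i => x i) =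
    gaussianDensity 0 (principal D (G.block c))
      (fun b => ((1 + D⁻¹ * L : Matrix V V ℝ) *ᵥ (x - m)) (b : V)) := by
  have hpos := gaussianDensity_pos (fun i : G.pa c => m i) (posDef_principal hS (G.pa c)).inv
    (fun i => x i)
  have hDc : 0 < (principal D (G.block c)).det := (posDef_principal hD _).det_pos
  have hcard : Fintype.card (G.family c) = Fintype.card (G.block c) + Fintype.card (G.pa c) := by
    rw [← Fintype.card_congr (G.familyEquiv c), Fintype.card_sum]
  rw [div_eq_iff hpos.ne']
  have hsub : ∀ I : Finset V, ((fun i : I => x i) - fun i : I => m i) = fun i : I => (x - m) i :=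
    fun _ => rfl
  simp only [gaussianDensity, hsub, hm.dotProduct_sub h hS hD, hm.det_inv h hS, hcard, sub_zero,
    Real.sqrt_mul hDc.le, pow_add, neg_add, add_div, Real.exp_add]
  ring

/-- As `D` is block diagonal, the conditional densities multiply to a density with precision `D` in
the residuals; the change to `x - m` is unipotent and leaves the determinant unchanged. -/
theorem LocalMatch.prod_gaussianDensity_div [Fintype G.und.ConnectedComponent]
    (hm : G.LocalMatch S (D + L)) (h : G.IsLocalPair D L)
    (hS : S.PosDef) (hD : D.PosDef) (m x : V → ℝ) :
    ∏ c, gaussianDensity (fun i : G.family c => m i) (principal S (G.family c))⁻¹ (fun i => x i) /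
      gaussianDensity (fun i : G.pa c => m i) (principal S (G.pa c))⁻¹ (fun i => x i) =
    gaussianDensity m (gluedPrecision D L) x := by
  have hdet : IsUnit D.det := hD.det_pos.ne'.isUnit
  have hDc : ∀ c, 0 < (principal D (G.block c)).det := fun c => (posDef_principal hD _).det_pos
  simp only [hm.gaussianDensity_div h hS hD]
  have hsqrt : ∏ c, √(principal D (G.block c)).det = √D.det := by
    rw [det_eq_prod_principal_block h.comp_eq, Real.sqrt_prod _ fun c _ => (hDc c).le]
  simp only [gaussianDensity, Finset.prod_mul_distrib, hsqrt, Finset.prod_pow_eq_pow_sum,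
    sum_card_block, ← Real.exp_sum, ← Finset.sum_div, Finset.sum_neg_distrib, sub_zero,
    sum_dotProduct_principal_block h.comp_eq, h.det_gluedPrecision hdet]
  congr 4
  rw [gluedPrecision, ← mulVec_mulVec, ← mulVec_mulVec, dotProduct_mulVec _ _ᵀ, vecMul_transpose]

end ChainGraph

/-! ### The induced moral graph and the factorization property. -/

namespace ChainGraph

open Matrix

section InducedMoral

variable {V : Type*} [Fintype V] {G : ChainGraph V} {c : G.und.ConnectedComponent}

/-- A node of the component has no child in the family, so moralization adds no edge at it. -/
theorem adj_or_dir_of_moral_adj {i j : G.family c} (hi : (i : V) ∈ G.block c)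
    (h : (G.induce (G.family c)).moral.Adj i j) : G.und.Adj i j ∨ G.dir j i := by
  have hno : ∀ v : G.family c, ¬ G.dir i v := fun v hv =>
    G.not_before_of_mem_family (b := (i : V)) (v := v) (by rw [G.mem_block.1 hi]; exact v.2)
      (before_of_dir hv rfl)
  rcases h.2 with (h | h) | ⟨c', ⟨v, _, hv⟩, _⟩
  · exact Or.inl h
  · rcases h.2 with h | h
    · exact absurd h (hno j)
    · exact Or.inr h
  · exact absurd hv (hno v)

theorem moral_adj_of_adj {i j : G.family c} (h : G.und.Adj i j) :
    (G.induce (G.family c)).moral.Adj i j :=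
  ⟨fun h0 => G.und.loopless.irrefl _ (h0 ▸ h), Or.inl (Or.inl h)⟩

theorem moral_adj_of_dir {i j : G.family c} (h : G.dir j i) :
    (G.induce (G.family c)).moral.Adj i j := by
  have hij : i ≠ j := fun h0 => not_dir_of_comp_eq rfl (h0 ▸ h)
  exact ⟨hij, Or.inl (Or.inr ⟨hij, Or.inr h⟩)⟩

/-- Undirected routes from a node of `c` stay in `c`, so `c` does not split in the induced subgraph
and all its parents get married there. -/
theorem induce_reachable {i j : G.family c} (hi : (i : V) ∈ G.block c) (hj : (j : V) ∈ G.block c) :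
    (G.induce (G.family c)).und.Reachable i j := by
  rw [mem_block] at hi hj
  have hr := SimpleGraph.ConnectedComponent.exact (hi.trans hj.symm)
  rw [SimpleGraph.reachable_iff_reflTransGen] at hr
  have key : ∀ v, Relation.ReflTransGen G.und.Adj (i : V) v → ∃ hv : v ∈ G.family c,
      (G.induce (G.family c)).und.Reachable i ⟨v, hv⟩ := by
    intro v hv
    induction hv with
    | refl => exact ⟨i.2, .refl _⟩
    | @tail a b h1 h2 ih =>
      obtain ⟨ha, hr⟩ := ih
      have hb : G.comp b = c := by
        rw [← hi]
        refine (SimpleGraph.ConnectedComponent.sound ?_).symm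
        rw [SimpleGraph.reachable_iff_reflTransGen]
        exact h1.tail h2
      refine ⟨G.mem_family.2 (Or.inl (G.mem_block.2 hb)), hr.trans (SimpleGraph.Adj.reachable ?_)⟩
      exact h2
  obtain ⟨_, h⟩ := key j hr
  exact h

theorem moral_adj_of_mem_pa {i j : G.family c} (hij : i ≠ j) (hi : (i : V) ∈ G.pa c)
    (hj : (j : V) ∈ G.pa c) : (G.induce (G.family c)).moral.Adj i j := by
  obtain ⟨a, ha, hia⟩ := G.mem_pa.1 hi
  obtain ⟨b, hb, hjb⟩ := G.mem_pa.1 hj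
  have ha' := G.mem_block.2 ha
  have hb' := G.mem_block.2 hb
  let a' : G.family c := ⟨a, G.mem_family.2 (Or.inl ha')⟩
  let b' : G.family c := ⟨b, G.mem_family.2 (Or.inl hb')⟩
  refine ⟨hij, Or.inr ⟨(G.induce (G.family c)).und.connectedComponentMk a', ⟨a', rfl, hia⟩, ?_⟩⟩
  exact ⟨b', SimpleGraph.ConnectedComponent.sound (induce_reachable hb' ha'), hjb⟩

end InducedMoral

section Factorization

variable {V : Type*} [Fintype V] [DecidableEq V] {G : ChainGraph V} {S D L : Matrix V V ℝ}

/-- Both sides are almost everywhere equal to continuous Gaussian densities with the same mean, so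
they agree almost everywhere iff the precision matrices coincide. The `Fintype` argument is left
free to unify with the instance in `Factorizes`. -/
theorem LocalMatch.ae_density_eq_iff (hm : G.LocalMatch S (D + L)) (h : G.IsLocalPair D L)
    (hS : S.PosDef) (hD : D.PosDef) (m : EuclideanSpace ℝ V)
    {_ : Fintype G.und.ConnectedComponent} :
    (∀ᵐ x : V → ℝ, density (multivariateGaussian m S) Finset.univ (Finset.univ.restrict x) =
      ∏ c, G.condDensity (multivariateGaussian m S) c x) ↔ S⁻¹ = gluedPrecision D L := by
  have hleft : ∀ᵐ x : V → ℝ,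
      density (multivariateGaussian m S) Finset.univ (Finset.univ.restrict x) =
        gaussianDensity (fun i => m i) S⁻¹ x := by
    filter_upwards [density_restrict_multivariateGaussian m hS Finset.univ] with x hx
    rw [hx]
    let e : (Finset.univ : Finset V) ≃ V := Equiv.subtypeUnivEquiv Finset.mem_univ
    rw [← gaussianDensity_comp_equiv e]
    have : (S.submatrix e e)⁻¹ = S⁻¹.submatrix e e := inv_submatrix_equiv S e e
    rw [← this]
    rfl
  have hright : ∀ᵐ x : V → ℝ, ∏ c, G.condDensity (multivariateGaussian m S) c x =
      gaussianDensity (fun i => m i) (gluedPrecision D L) x := by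
    filter_upwards [ae_all_iff.2 fun c => density_restrict_multivariateGaussian m hS (G.family c),
      ae_all_iff.2 fun c => density_restrict_multivariateGaussian m hS (G.pa c)] with x h1 h2
    rw [← hm.prod_gaussianDensity_div h hS hD]
    refine Finset.prod_congr rfl fun c _ => ?_
    rw [condDensity, h1, h2]
    rfl
  constructor
  · intro h0
    refine precision_eq_of_gaussianDensity_eq (m := fun i => m i) hS.inv
      (h.posDef_gluedPrecision hD).isHermitian ?_
    rw [← (continuous_gaussianDensity _ _).ae_eq_iff_eq volume (continuous_gaussianDensity _ _)]
    filter_upwards [hleft, hright, h0] with x h1 h2 h3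
    rw [← h1, ← h2, h3]
  · intro h0
    filter_upwards [hleft, hright] with x h1 h2
    rw [h1, h2, h0]

theorem covMatrix_multivariateGaussian (m : EuclideanSpace ℝ V) (hS : S.PosSemidef) :
    covMatrix (multivariateGaussian m S) = S := by
  ext i j
  exact covariance_eval_multivariateGaussian hS i j

theorem localPrecision_multivariateGaussian (m : EuclideanSpace ℝ V) (hS : S.PosSemidef)
    (c : G.und.ConnectedComponent) :
    G.localPrecision (multivariateGaussian m S) c = (principal S (G.family c))⁻¹ := by
  rw [localPrecision, covMatrix_multivariateGaussian m hS]
  rfl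

theorem integral_eval_multivariateGaussian (m : EuclideanSpace ℝ V) (v : V) :
    ∫ x, x v ∂(multivariateGaussian m S) = m v := by
  have h := ContinuousLinearMap.integral_comp_comm (EuclideanSpace.proj (𝕜 := ℝ) v)
    (IsGaussian.integrable_id (μ := multivariateGaussian m S))
  simpa using h

theorem principal_inv_apply_eq_zero {m : EuclideanSpace ℝ V} (hS : S.PosDef)
    (h : G.Factorizes (multivariateGaussian m S)) {c : G.und.ConnectedComponent}
    {i j : G.family c} (hij : i ≠ j) (hadj : ¬ (G.induce (G.family c)).moral.Adj i j) :
    (principal S (G.family c))⁻¹ i j = 0 := by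
  obtain ⟨ψ, _, hψ⟩ := h.2 c
  refine precision_eq_zero_of_factorization _ (fun i : G.family c => m i)
    (posDef_principal hS _).inv ψ ?_ hij hadj
  filter_upwards [hψ, density_multivariateGaussian m hS (G.family c)] with x h1 h2
  rw [← h1, h2]
  rfl

theorem LocalMatch.factorizes (hm : G.LocalMatch S (D + L)) (h : G.IsLocalPair D L)
    (hS : S.PosDef) (hD : D.PosDef) (hSg : S⁻¹ = gluedPrecision D L)
    (hund : ∀ i j, D i j ≠ 0 → i = j ∨ G.und.Adj i j) (m : EuclideanSpace ℝ V) :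
    G.Factorizes (multivariateGaussian m S) := by
  refine ⟨(hm.ae_density_eq_iff h hS hD m).2 hSg, fun c => ?_⟩
  have hQ := (posDef_principal hS (G.family c)).inv
  have hrow : ∀ i j : G.family c, (i : V) ∈ G.block c → i ≠ j →
      ¬ (G.induce (G.family c)).moral.Adj i j → (principal S (G.family c))⁻¹ i j = 0 := by
    intro i j hi hij hadj
    rw [hm c i j hi, Matrix.add_apply]
    have hD0 : D i j = 0 := by
      by_contra h0
      rcases hund i j h0 with h1 | h1
      · exact hij (Subtype.ext h1)
      · exact hadj (moral_adj_of_adj h1)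
    have hL0 : L i j = 0 := by
      by_contra h0
      exact hadj (moral_adj_of_dir (h.dir i j h0))
    rw [hD0, hL0, add_zero]
  obtain ⟨ψ, hψ0, hψ⟩ := exists_factorization_of_precision (G.induce (G.family c)).moral
    (fun i : G.family c => m i) (principal S (G.family c))⁻¹ (by
      -- A nonadjacent pair has a member in the component, since two parents are always married;
      -- symmetry then reduces to its row.
      intro i j hij hadj
      rcases G.mem_family.1 i.2 with hi | hi
      · exact hrow i j hi hij hadj
      rcases G.mem_family.1 j.2 with hj | hj
      · rw [← hQ.isHermitian.apply, hrow j i hj hij.symm fun h => hadj h.symm, star_zero]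
      · exact absurd (moral_adj_of_mem_pa hij hi hj) hadj)
  refine ⟨ψ, hψ0, ?_⟩
  filter_upwards [density_multivariateGaussian m hS (G.family c)] with x hx
  rw [hx, ← hψ]
  rfl

end Factorization

/-! ### The parameter matrices and the image of the parameterization. -/

section Parameters

variable {V : Type*} [LinearOrder V] (G : ChainGraph V)

open Classical in
/-- The symmetric matrix of the parameters of the nodes and the undirected edges. -/
noncomputable def undMatrix (θ : G.NdIndex → ℝ) : Matrix V V ℝ := fun j k =>
  if j = k then θ (.diag j)
  else if h : G.und.Adj j k then
    if hlt : k < j then θ (.undirected j k h hlt)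
    else if hlt : j < k then θ (.undirected k j h.symm hlt) else 0
  else 0

open Classical in
/-- The matrix of the parameters of the directed edges. -/
noncomputable def dirMatrix (θ : G.NdIndex → ℝ) : Matrix V V ℝ := fun j k =>
  if h : G.dir k j then θ (.directed j k h) else 0

variable {G} {θ : G.NdIndex → ℝ}

theorem undMatrix_self (v : V) : G.undMatrix θ v v = θ (.diag v) := by simp [undMatrix]

theorem undMatrix_of_lt {j k : V} (h : G.und.Adj j k) (hlt : k < j) :
    G.undMatrix θ j k = θ (.undirected j k h hlt) := by
  simp [undMatrix, h, hlt, hlt.ne']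

theorem undMatrix_comm (j k : V) : G.undMatrix θ j k = G.undMatrix θ k j := by
  wlog hlt : k < j generalizing j k
  · rcases (not_lt.1 hlt).eq_or_lt with rfl | h
    · rfl
    · exact (this k j h).symm
  by_cases h : G.und.Adj j k
  · simp [undMatrix, hlt.ne, hlt.ne', hlt, hlt.not_gt, h, h.symm]
  · have h' : ¬ G.und.Adj k j := fun h' => h h'.symm
    simp [undMatrix, hlt.ne, hlt.ne', h, h']

theorem isHermitian_undMatrix : (G.undMatrix θ).IsHermitian := by
  ext j k
  exact undMatrix_comm k j

theorem undMatrix_of_not_adj {j k : V} (hne : j ≠ k) (h : ¬ G.und.Adj j k) :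
    G.undMatrix θ j k = 0 := by
  simp [undMatrix, hne, h]

theorem dirMatrix_of_dir {j k : V} (h : G.dir k j) :
    G.dirMatrix θ j k = θ (.directed j k h) := by
  simp [dirMatrix, h]

theorem dirMatrix_of_not_dir {j k : V} (h : ¬ G.dir k j) : G.dirMatrix θ j k = 0 := by
  simp [dirMatrix, h]

theorem eq_or_adj_of_undMatrix_ne_zero (j k : V) (h : G.undMatrix θ j k ≠ 0) :
    j = k ∨ G.und.Adj j k := by
  by_contra! h0
  exact h (undMatrix_of_not_adj h0.1 h0.2)

theorem isLocalPair_parameters : G.IsLocalPair (G.undMatrix θ) (G.dirMatrix θ) where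
  comp_eq u v h := by
    rcases eq_or_adj_of_undMatrix_ne_zero u v h with rfl | h
    · rfl
    · exact SimpleGraph.ConnectedComponent.sound h.reachable
  dir u v h := by
    by_contra h0
    exact h (dirMatrix_of_not_dir h0)

theorem continuous_undMatrix : Continuous fun θ : G.NdIndex → ℝ => G.undMatrix θ := by
  refine continuous_matrix fun j k => ?_
  unfold undMatrix
  split_ifs <;> fun_prop

theorem nonempty_setOf_posDef_undMatrix [Finite V] :
    {θ : G.NdIndex → ℝ | (G.undMatrix θ).PosDef}.Nonempty := by
  classical
  -- This parameter vector gives the identity matrix.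
  refine ⟨fun | .diag _ => 1 | _ => 0, ?_⟩
  rw [Set.mem_ofPred_eq]
  convert PosDef.one (n := V) (R := ℝ) using 1
  ext j k
  rw [one_apply]
  unfold undMatrix
  split_ifs <;> rfl

variable [Fintype V]

/-- Entries that are not parameters are either mirror images of undirected ones or, by the
factorization, zero. -/
theorem localMatch_ndParam {m : EuclideanSpace ℝ V} {S : Matrix V V ℝ} (hS : S.PosDef)
    (h : G.Factorizes (multivariateGaussian m S)) :
    G.LocalMatch S (G.undMatrix (G.ndParam (multivariateGaussian m S)) +
      G.dirMatrix (G.ndParam (multivariateGaussian m S))) := by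
  set p := multivariateGaussian m S with hp
  -- The parameters refer to the family of `G.comp u`, whose index type must be transported along
  -- `G.comp u = c`.
  have hentry : ∀ {c : G.und.ConnectedComponent} {u v : V} (hu : u ∈ G.family c)
      (hv : v ∈ G.family c) (hu' : u ∈ G.family (G.comp u)) (hv' : v ∈ G.family (G.comp u)),
      G.comp u = c → G.localPrecision p (G.comp u) ⟨u, hu'⟩ ⟨v, hv'⟩ =
        (principal S (G.family c))⁻¹ ⟨u, hu⟩ ⟨v, hv⟩ := by
    rintro _ u v hu hv hu' hv' rfl
    rw [hp, localPrecision_multivariateGaussian m hS.posSemidef]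
  rintro c ⟨i, hi⟩ ⟨j, hj⟩ hib
  have hQ := (posDef_principal hS (G.family c)).inv
  have hic := G.mem_block.1 hib
  change _ = G.undMatrix (G.ndParam p) i j + G.dirMatrix (G.ndParam p) i j
  by_cases hij : i = j
  · subst hij
    rw [dirMatrix_of_not_dir (not_dir_of_comp_eq rfl), undMatrix_self, add_zero]
    exact (hentry _ _ _ _ hic).symm
  by_cases hadj : G.und.Adj i j
  · have hcomp : G.comp i = G.comp j := SimpleGraph.ConnectedComponent.sound hadj.reachable
    rw [dirMatrix_of_not_dir (not_dir_of_comp_eq hcomp.symm), add_zero]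
    rcases lt_or_gt_of_ne hij with hlt | hlt
    · rw [undMatrix_comm, undMatrix_of_lt hadj.symm hlt, ← hQ.isHermitian.apply, star_trivial]
      exact (hentry _ _ _ _ (hcomp.symm.trans hic)).symm
    · rw [undMatrix_of_lt hadj hlt]
      exact (hentry _ _ _ _ hic).symm
  rw [undMatrix_of_not_adj hij hadj, zero_add]
  by_cases hdir : G.dir j i
  · rw [dirMatrix_of_dir hdir]
    exact (hentry _ _ _ _ hic).symm
  rw [dirMatrix_of_not_dir hdir]
  refine principal_inv_apply_eq_zero hS h (fun h0 => hij (congrArg Subtype.val h0)) fun h0 => ?_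
  exact (adj_or_dir_of_moral_adj hib h0).elim hadj hdir

theorem posDef_undMatrix_ndParam {m : EuclideanSpace ℝ V} {S : Matrix V V ℝ} (hS : S.PosDef)
    (h : G.Factorizes (multivariateGaussian m S)) :
    (G.undMatrix (G.ndParam (multivariateGaussian m S))).PosDef := by
  classical
  refine posDef_of_principal_block isLocalPair_parameters.comp_eq isHermitian_undMatrix fun c => ?_
  rw [← (localMatch_ndParam hS h).submatrix_inl isLocalPair_parameters]
  exact (posDef_principal hS _).inv.submatrix ((G.familyEquiv c).injective.comp Sum.inl_injective)

theorem inv_eq_gluedPrecision_ndParam {m : EuclideanSpace ℝ V} {S : Matrix V V ℝ} (hS : S.PosDef)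
    (h : G.Factorizes (multivariateGaussian m S)) :
    S⁻¹ = gluedPrecision (G.undMatrix (G.ndParam (multivariateGaussian m S)))
      (G.dirMatrix (G.ndParam (multivariateGaussian m S))) :=
  ((localMatch_ndParam hS h).ae_density_eq_iff isLocalPair_parameters hS
    (posDef_undMatrix_ndParam hS h) m).1 h.1

theorem injOn_ndParam : Set.InjOn G.ndParam G.gaussians := by
  rintro _ ⟨⟨m, S, hS, rfl⟩, hp⟩ _ ⟨⟨m', S', hS', rfl⟩, hq⟩ heq
  have h1 := inv_eq_gluedPrecision_ndParam hS hp
  have h2 := inv_eq_gluedPrecision_ndParam hS' hq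
  rw [heq, ← h2] at h1
  have hSS : S = S' := by
    rw [← nonsing_inv_nonsing_inv S hS.det_pos.ne'.isUnit, h1,
      nonsing_inv_nonsing_inv S' hS'.det_pos.ne'.isUnit]
  have hmm : m = m' := by
    ext v
    have := congrFun heq (.mean v)
    simpa only [ndParam, integral_eval_multivariateGaussian] using this
  rw [hSS, hmm]

theorem exists_ndParam_eq (hθ : (G.undMatrix θ).PosDef) : ∃ p ∈ G.gaussians, G.ndParam p = θ := by
  have hpair := isLocalPair_parameters (θ := θ)
  set S := (gluedPrecision (G.undMatrix θ) (G.dirMatrix θ))⁻¹ with hSdef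
  have hS : S.PosDef := (hpair.posDef_gluedPrecision hθ).inv
  have hSg : S⁻¹ = gluedPrecision (G.undMatrix θ) (G.dirMatrix θ) :=
    nonsing_inv_nonsing_inv _ (hpair.posDef_gluedPrecision hθ).det_pos.ne'.isUnit
  have hm : G.LocalMatch S (G.undMatrix θ + G.dirMatrix θ) := hpair.localMatch hθ
  set m : EuclideanSpace ℝ V := WithLp.toLp 2 fun v => θ (.mean v) with hmdef
  refine ⟨multivariateGaussian m S, ⟨⟨m, S, hS, rfl⟩,
    hm.factorizes hpair hS hθ hSg eq_or_adj_of_undMatrix_ne_zero m⟩, ?_⟩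
  have hentry : ∀ {u v : V} (hu : u ∈ G.family (G.comp u)) (hv : v ∈ G.family (G.comp u)),
      G.localPrecision (multivariateGaussian m S) (G.comp u) ⟨u, hu⟩ ⟨v, hv⟩ =
        G.undMatrix θ u v + G.dirMatrix θ u v := by
    intro u v hu hv
    rw [localPrecision_multivariateGaussian m hS.posSemidef]
    exact hm _ ⟨u, hu⟩ ⟨v, hv⟩ (G.mem_block.2 rfl)
  ext (v | v | ⟨j, k, h, hlt⟩ | ⟨j, k, h⟩)
  · exact integral_eval_multivariateGaussian m v
  · rw [ndParam, hentry, undMatrix_self, dirMatrix_of_not_dir (not_dir_of_comp_eq rfl), add_zero]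
  · have hcomp : G.comp k = G.comp j := SimpleGraph.ConnectedComponent.sound h.symm.reachable
    rw [ndParam, hentry, undMatrix_of_lt h hlt, dirMatrix_of_not_dir (not_dir_of_comp_eq hcomp),
      add_zero]
  · have hjk : j ≠ k := by
      rintro rfl
      exact not_dir_of_comp_eq rfl h
    rw [ndParam, hentry, dirMatrix_of_dir h, undMatrix_of_not_adj hjk, zero_add]
    exact fun h0 => not_dir_of_comp_eq (SimpleGraph.ConnectedComponent.sound h0.symm.reachable) h

theorem image_ndParam_gaussians :
    G.ndParam '' G.gaussians = {θ | (G.undMatrix θ).PosDef} := by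
  ext θ
  constructor
  · rintro ⟨_, ⟨⟨m, S, hS, rfl⟩, hp⟩, rfl⟩
    exact posDef_undMatrix_ndParam hS hp
  · intro hθ
    obtain ⟨p, hp, h⟩ := exists_ndParam_eq hθ
    exact ⟨p, hp, h⟩

/-- By homogeneity positivity need only be tested on the unit sphere; this is compact and the form
is jointly continuous, so positivity persists near `θ`. -/
theorem isOpen_setOf_posDef_undMatrix : IsOpen {θ : G.NdIndex → ℝ | (G.undMatrix θ).PosDef} := by
  have hiff : ∀ θ : G.NdIndex → ℝ, (G.undMatrix θ).PosDef ↔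
      ∀ x ∈ Metric.sphere (0 : V → ℝ) 1, 0 < x ⬝ᵥ G.undMatrix θ *ᵥ x := by
    intro θ
    refine ⟨fun h x hx => ?_, fun h => PosDef.of_dotProduct_mulVec_pos isHermitian_undMatrix
      fun x hx => ?_⟩
    · have hx0 : x ≠ 0 := by
        rintro rfl
        simp at hx
      simpa using h.dotProduct_mulVec_pos hx0
    · have hn : 0 < ‖x‖ := norm_pos_iff.2 hx
      have h1 := h (‖x‖⁻¹ • x) (by simp [norm_smul, hn.ne'])
      rw [mulVec_smul, smul_dotProduct, dotProduct_smul, smul_eq_mul, smul_eq_mul] at h1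
      rw [star_trivial]
      have hi : 0 ≤ ‖x‖⁻¹ := (inv_pos.2 hn).le
      exact pos_of_mul_pos_right (pos_of_mul_pos_right h1 hi) hi
  have hcont : Continuous fun z : (G.NdIndex → ℝ) × (V → ℝ) => z.2 ⬝ᵥ G.undMatrix z.1 *ᵥ z.2 := by
    have h1 : Continuous fun z : (G.NdIndex → ℝ) × (V → ℝ) => G.undMatrix z.1 :=
      continuous_undMatrix.comp continuous_fst
    exact continuous_snd.dotProduct (h1.matrix_mulVec continuous_snd)
  simp only [hiff]
  refine isOpen_iff_eventually.2 fun θ hθ => ?_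
  exact (isCompact_sphere (0 : V → ℝ) 1).eventually_forall_of_forall_eventually fun x hx =>
    hcont.continuousAt.eventually (lt_mem_nhds (hθ x hx))

theorem card_ndIndex : Fintype.card G.NdIndex = G.dim := by
  have hskel : ∀ {j k : V}, G.dir k j → s(j, k) ∈ G.skeleton.edgeSet := fun {j k} h =>
    Or.inr ⟨fun h0 : j = k => not_dir_of_comp_eq rfl (h0 ▸ h), Or.inr h⟩
  let f : G.NdIndex → V ⊕ V ⊕ G.skeleton.edgeSet := fun
    | .mean v => .inl v
    | .diag v => .inr (.inl v)
    | .undirected j k h _ => .inr (.inr ⟨s(j, k), Or.inl h⟩)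
    | .directed j k h => .inr (.inr ⟨s(j, k), hskel h⟩)
  have hmix : ∀ {j k}, G.und.Adj j k → ¬ G.dir j k := fun h =>
    not_dir_of_comp_eq (SimpleGraph.ConnectedComponent.sound h.reachable)
  have hf : Function.Bijective f := by
    constructor
    · rintro (v | v | ⟨j, k, h, hlt⟩ | ⟨j, k, h⟩) (v' | v' | ⟨j', k', h', hlt'⟩ | ⟨j', k', h'⟩) heq <;>
        simp only [f, reduceCtorEq, Sum.inl.injEq, Sum.inr.injEq] at heq
      · rw [heq]
      · rw [heq]
      · rcases Sym2.eq_iff.1 (congrArg Subtype.val heq) with ⟨rfl, rfl⟩ | ⟨rfl, rfl⟩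
        · rfl
        -- The condition `k < j` makes each undirected edge count once.
        · exact absurd hlt hlt'.not_gt
      · rcases Sym2.eq_iff.1 (congrArg Subtype.val heq) with ⟨rfl, rfl⟩ | ⟨rfl, rfl⟩
        · exact absurd h' (hmix h.symm)
        · exact absurd h' (hmix h)
      · rcases Sym2.eq_iff.1 (congrArg Subtype.val heq) with ⟨rfl, rfl⟩ | ⟨rfl, rfl⟩
        · exact absurd h (hmix h'.symm)
        · exact absurd h (hmix h')
      · rcases Sym2.eq_iff.1 (congrArg Subtype.val heq) with ⟨rfl, rfl⟩ | ⟨rfl, rfl⟩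
        · rfl
        -- Opposite arrows between two nodes would form a pseudocycle.
        · exact absurd ((before_of_dir h rfl).trans (before_of_dir h' rfl)) (not_before_self _)
    · rintro (v | v | ⟨e, he⟩)
      · exact ⟨.mean v, rfl⟩
      · exact ⟨.diag v, rfl⟩
      induction e with
      | _ j k =>
        rcases he with he | ⟨hne, he | he⟩
        · rcases lt_or_gt_of_ne he.ne with hlt | hlt
          · exact ⟨.undirected k j he.symm hlt, by simp [f, Sym2.eq_swap]⟩
          · exact ⟨.undirected j k he hlt, rfl⟩
        · exact ⟨.directed k j he, by simp [f, Sym2.eq_swap]⟩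
        · exact ⟨.directed j k he, rfl⟩
  rw [← Nat.card_eq_fintype_card, Nat.card_congr (Equiv.ofBijective f hf), Nat.card_sum,
    Nat.card_sum, Nat.card_coe_set_eq, Nat.card_eq_fintype_card, dim, numEdges]
  ring

end Parameters

end ChainGraph

theorem theorem1 {V : Type*} [Fintype V] [LinearOrder V] (G : ChainGraph V) :
    Fintype.card G.NdIndex = G.dim ∧
    Set.InjOn G.ndParam G.gaussians ∧
    MeasurableSet (G.ndParam '' G.gaussians) ∧
    0 < volume (G.ndParam '' G.gaussians) := by
  refine ⟨ChainGraph.card_ndIndex, ChainGraph.injOn_ndParam, ?_⟩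
  rw [ChainGraph.image_ndParam_gaussians]
  exact ⟨ChainGraph.isOpen_setOf_posDef_undMatrix.measurableSet,
    ChainGraph.isOpen_setOf_posDef_undMatrix.measure_pos volume
      ChainGraph.nonempty_setOf_posDef_undMatrix⟩
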